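/- For integers $L \ge 0$ and $M \ge 1$ let $\bar B$ be the $M\times(L+1)$ real Vandermonde matrix with nodes $\tfrac1M,\tfrac2M,\dots,1$, that is, $\bar B_{ij} = (i/M)^{j}$ for $1\le i\le M$, $0\le j\le L$. Let $\sigma_{\min}$ denote the smallest singular value of a matrix (the square root of the smallest eigenvalue of its Gram matrix $A^\top A$). (a) For all integers $L\ge 1$ and $M\ge L+1$, $$\sigma_{\min}\!\left(\frac{\bar B}{\sqrt M}\right)\ \ge\ \frac{1}{L^2\,2^{7L}\,(2L+1)}\left(\frac{M+L}{eM}\right)^{L+\frac12}.$$ (b) Consequently, there is an absolute constant $c>0$ such that for all integers $L\ge 0$ and $M\ge L+1$ and every real polynomial $p(x)=\sum_{i=0}^{L} w_i x^i$ of degree at most $L$, $$\max_{0\le i\le L}|w_i|\ \le\ e^{cL}\max_{x\in\{\frac1M,\frac2M,\dots,1\}}|p(x)|.$$ -/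

import Mathlib

/-- The smallest singular value of a real `m × n` matrix `A`: the last of its `n` singular values
(the square roots of the eigenvalues of `Aᵀ A`, listed with multiplicity in decreasing order and
indexed from `0`). -/
noncomputable def sigmaMin {m n : ℕ} (A : Matrix (Fin m) (Fin n) ℝ) : ℝ :=
  (Matrix.toEuclideanLin A).singularValues (n - 1)

/-- The `i`-th point `(i + 1) / M` of the grid `{1/M, 2/M, …, 1}`, indexed from `i = 0`. -/
noncomputable def gridPoint (M : ℕ) (i : Fin M) : ℝ := ((i : ℝ) + 1) / M

/-- The `M × (L + 1)` Vandermonde matrix with nodes `1/M, 2/M, …, 1`; column `j` (indexed from `0`)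
holds the `j`-th powers of the nodes. -/
noncomputable def vandermondeGrid (M L : ℕ) : Matrix (Fin M) (Fin (L + 1)) ℝ :=
  Matrix.of fun i j => gridPoint M i ^ (j : ℕ)

open Polynomial Finset

/-! With `s = M / (L + 1)`, the grid contains `s` disjoint interleaved families of `L + 1`
equispaced nodes, each with spacing `s / M` at least `1 / (2 (L + 1))`. Such nodes are separated
well enough for the Lagrange basis to have coefficient sum at most `32 ^ L`
(`sum_abs_coeff_lagrange_basis_le`), so values on one family control all coefficients. One family
gives (b). Summing squares over all families (`sq_sum_abs_coeff_le`) gives a bound for the singular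
value that is uniform in `M` and stronger than (a). -/

/-- Multiplying by a linear factor `X - a` increases a partial sum of absolute values of
coefficients by a factor of at most `1 + |a|`. -/
lemma sum_abs_coeff_mul_X_sub_C_le (p : ℝ[X]) (a : ℝ) (n : ℕ) :
    ∑ i ∈ range n, |(p * (X - C a)).coeff i| ≤ (1 + |a|) * ∑ i ∈ range n, |p.coeff i| := by
  have h : ∀ n, ∑ i ∈ range n, |(p * X).coeff i| ≤ ∑ i ∈ range n, |p.coeff i| := by
    intro n
    cases n with
    | zero => simp
    | succ n =>
      rw [sum_range_succ']
      simp only [coeff_mul_X, mul_coeff_zero, coeff_X_zero, mul_zero, abs_zero, add_zero]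
      exact sum_le_sum_of_subset_of_nonneg (range_mono n.le_succ) fun _ _ _ => abs_nonneg _
  calc ∑ i ∈ range n, |(p * (X - C a)).coeff i|
      ≤ ∑ i ∈ range n, (|(p * X).coeff i| + |a| * |p.coeff i|) := by
        refine sum_le_sum fun i _ => ?_
        rw [mul_sub, coeff_sub, coeff_mul_C, mul_comm |a|, ← abs_mul]
        exact abs_sub _ _
    _ ≤ (1 + |a|) * ∑ i ∈ range n, |p.coeff i| := by
        rw [sum_add_distrib, ← mul_sum, add_mul, one_mul]
        exact add_le_add_left (h n) _

lemma sum_abs_coeff_prod_X_sub_C_le {ι : Type*} [DecidableEq ι] (t : Finset ι) (v : ι → ℝ)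
    (n : ℕ) :
    ∑ i ∈ range n, |(∏ j ∈ t, (X - C (v j))).coeff i| ≤ ∏ j ∈ t, (1 + |v j|) := by
  induction t using Finset.induction_on with
  | empty =>
    simp only [prod_empty, coeff_one]
    rw [sum_congr rfl (g := fun i => if i = 0 then (1 : ℝ) else 0)
      (fun i _ => by split_ifs <;> simp), sum_ite_eq']
    split_ifs <;> norm_num
  | insert a t ha ih =>
    rw [prod_insert ha, prod_insert ha, mul_comm (X - C (v a))]
    exact (sum_abs_coeff_mul_X_sub_C_le _ _ _).trans (by gcongr)

lemma prod_erase_abs_sub_natCast {L k : ℕ} (hk : k ≤ L) :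
    ∏ j ∈ (range (L + 1)).erase k, |(k : ℝ) - j| = (k.factorial : ℝ) * (L - k).factorial := by
  obtain ⟨m, rfl⟩ := Nat.exists_eq_add_of_le hk
  have hs : (range (k + m + 1)).erase k = range k ∪ (range m).image (fun j => k + 1 + j) := by
    ext j
    simp only [mem_erase, mem_range, mem_union, mem_image]
    constructor
    · rintro ⟨h1, h2⟩
      rcases lt_or_gt_of_ne h1 with h | h
      · exact Or.inl h
      · exact Or.inr ⟨j - (k + 1), by omega, by omega⟩
    · rintro (h | ⟨i, hi, rfl⟩) <;> omega
  have hd : Disjoint (range k) ((range m).image (fun j => k + 1 + j)) := by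
    rw [disjoint_left]
    simp only [mem_range, mem_image, not_exists, not_and]
    intro a ha x _ hx
    omega
  rw [hs, prod_union hd, prod_image (fun a _ b _ h => by simpa using h), Nat.add_sub_cancel_left]
  congr 1
  · rw [← prod_range_add_one_eq_factorial, ← prod_range_reflect, Nat.cast_prod]
    refine prod_congr rfl fun j hj => ?_
    have hj := mem_range.1 hj
    have e : k = (k - 1 - j) + (j + 1) := by omega
    have e' : (k : ℝ) = ((k - 1 - j : ℕ) : ℝ) + (j + 1) := by exact_mod_cast e
    rw [e', add_sub_cancel_left]
    push_cast
    rw [abs_of_nonneg (by positivity)]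
  · rw [← prod_range_add_one_eq_factorial, Nat.cast_prod]
    refine prod_congr rfl fun j _ => ?_
    push_cast
    rw [show (k : ℝ) - (k + 1 + j) = -(j + 1) by ring, abs_neg, abs_of_nonneg (by positivity)]

/-- An elementary substitute for Stirling: the product `(L + 1) ⋯ (2 L)` is `L!` times the central
binomial coefficient. -/
lemma succ_pow_le_four_pow_mul_factorial (L : ℕ) : (L + 1) ^ L ≤ 4 ^ L * L.factorial :=
  calc (L + 1) ^ L ≤ (L + 1).ascFactorial L := Nat.pow_succ_le_ascFactorial _ _
    _ = L.factorial * L.centralBinom := by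
      rw [Nat.ascFactorial_eq_factorial_mul_choose, Nat.centralBinom, two_mul]
    _ ≤ 4 ^ L * L.factorial := by
      rw [mul_comm]
      exact Nat.mul_le_mul_right _ (Nat.centralBinom_le_four_pow L)

lemma factorial_le_two_pow_mul {L k : ℕ} (hk : k ≤ L) :
    L.factorial ≤ 2 ^ L * (k.factorial * (L - k).factorial) := by
  rw [← Nat.choose_mul_factorial_mul_factorial hk, mul_assoc]
  exact Nat.mul_le_mul_right _ (Nat.choose_le_two_pow L k)

/-- The coefficients of the Lagrange basis on `L + 1` equispaced nodes of `[-1, 1]` with spacing at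
least `1 / (2 (L + 1))` are exponentially bounded. -/
lemma sum_abs_coeff_lagrange_basis_le {L k : ℕ} (hk : k ≤ L) {a h : ℝ}
    (hh : 1 ≤ 2 * (L + 1) * h) (hv : ∀ j ≤ L, |a + j * h| ≤ 1) (n : ℕ) :
    ∑ i ∈ range n,
      |(Lagrange.basis (range (L + 1)) (fun j : ℕ => a + j * h) k).coeff i| ≤ 32 ^ L := by
  set v : ℕ → ℝ := fun j => a + j * h with hvdef
  set t := (range (L + 1)).erase k with ht
  have hpos : 0 < h := by
    by_contra! hc
    nlinarith [mul_nonneg (by positivity : (0 : ℝ) ≤ 2 * (L + 1)) (neg_nonneg.2 hc)]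
  have hcard : #t = L := by
    rw [ht, card_erase_of_mem (mem_range.2 (by omega)), card_range, Nat.add_sub_cancel]
  have hD : ∏ j ∈ t, |v k - v j| = h ^ L * ((k.factorial : ℝ) * (L - k).factorial) := by
    have hconst : h ^ L = ∏ _j ∈ t, h := by rw [prod_const, hcard]
    rw [← prod_erase_abs_sub_natCast hk, hconst, ← ht, ← prod_mul_distrib]
    refine prod_congr rfl fun j _ => ?_
    rw [hvdef, ← abs_of_pos hpos, ← abs_mul, abs_of_pos hpos]
    congr 1
    ring
  have hfac : (0 : ℝ) < (k.factorial : ℝ) * (L - k).factorial := by positivity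
  have hDpos : 0 < ∏ j ∈ t, |v k - v j| := by rw [hD]; positivity
  have hN : ∏ j ∈ t, (1 + |v j|) ≤ 2 ^ L := by
    rw [← hcard, ← prod_const]
    refine prod_le_prod (fun _ _ => by positivity) fun j hj => ?_
    have := hv j (by have := mem_range.1 (mem_of_mem_erase hj); omega)
    simp only [hvdef]
    linarith
  -- 16 = 2 · 4 · 2: the spacing, the comparison of `(L + 1) ^ L` with `L!`, and the binomial
  -- coefficient.
  have hlow : 1 ≤ 16 ^ L * ∏ j ∈ t, |v k - v j| := by
    have h1 : ((L : ℝ) + 1) ^ L ≤ 4 ^ L * L.factorial := by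
      exact_mod_cast succ_pow_le_four_pow_mul_factorial L
    have h2 : (L.factorial : ℝ) ≤ 2 ^ L * (k.factorial * (L - k).factorial) := by
      exact_mod_cast factorial_le_two_pow_mul hk
    calc (1 : ℝ) ≤ (2 * (L + 1) * h) ^ L := one_le_pow₀ hh
      _ = 2 ^ L * h ^ L * ((L : ℝ) + 1) ^ L := by rw [mul_pow, mul_pow]; ring
      _ ≤ 2 ^ L * h ^ L * (4 ^ L * (2 ^ L * (k.factorial * (L - k).factorial))) := by
        gcongr
        exact h1.trans (by gcongr)
      _ = 16 ^ L * ∏ j ∈ t, |v k - v j| := by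
        rw [hD, show (16 : ℝ) = 2 * 4 * 2 by norm_num, mul_pow, mul_pow]; ring
  have hb : Lagrange.basis (range (L + 1)) v k =
      C (∏ j ∈ t, (v k - v j)⁻¹) * ∏ j ∈ t, (X - C (v j)) := by
    simp only [Lagrange.basis, Lagrange.basisDivisor, prod_mul_distrib, map_prod, ← ht]
  simp only [hb, coeff_C_mul, abs_mul, ← mul_sum]
  rw [prod_inv_distrib, abs_inv, abs_prod, inv_mul_le_iff₀ hDpos]
  calc ∑ i ∈ range n, |(∏ j ∈ t, (X - C (v j))).coeff i| ≤ 2 ^ L :=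
        (sum_abs_coeff_prod_X_sub_C_le t v n).trans hN
    _ ≤ 2 ^ L * (16 ^ L * ∏ j ∈ t, |v k - v j|) := le_mul_of_one_le_right (by positivity) hlow
    _ = (∏ j ∈ t, |v k - v j|) * 32 ^ L := by
        rw [show (32 : ℝ) = 2 * 16 by norm_num, mul_pow]; ring

/-- The coefficients of a polynomial of degree at most `L` are bounded by its values at `L + 1`
equispaced nodes. -/
lemma sum_abs_coeff_le_sum_abs_eval {L : ℕ} {a h : ℝ}
    (hh : 1 ≤ 2 * (L + 1) * h) (hv : ∀ j ≤ L, |a + j * h| ≤ 1) {p : ℝ[X]} (hp : p.natDegree ≤ L) :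
    ∑ i ∈ range (L + 1), |p.coeff i| ≤ 32 ^ L * ∑ k ∈ range (L + 1), |p.eval (a + k * h)| := by
  have hne : h ≠ 0 := by rintro rfl; norm_num at hh
  have hinj : Set.InjOn (fun j : ℕ => a + j * h) (range (L + 1)) := fun i _ j _ hij => by
    simpa [hne] using hij
  have hdeg : p.degree < #(range (L + 1)) := by
    rw [card_range]
    exact (natDegree_le_iff_degree_le.1 hp).trans_lt (by exact_mod_cast L.lt_succ_self)
  have hpeq := Lagrange.eq_interpolate hinj hdeg
  rw [Lagrange.interpolate_apply] at hpeq
  have hc : ∀ i, |p.coeff i| ≤ ∑ k ∈ range (L + 1), |p.eval (a + k * h)| *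
      |(Lagrange.basis (range (L + 1)) (fun j : ℕ => a + j * h) k).coeff i| := by
    intro i
    conv_lhs => rw [hpeq]
    rw [finsetSum_coeff]
    refine (abs_sum_le_sum_abs _ _).trans (le_of_eq ?_)
    simp only [coeff_C_mul, abs_mul]
  calc ∑ i ∈ range (L + 1), |p.coeff i|
      ≤ ∑ k ∈ range (L + 1), |p.eval (a + k * h)| * ∑ i ∈ range (L + 1),
          |(Lagrange.basis (range (L + 1)) (fun j : ℕ => a + j * h) k).coeff i| := by
        simp only [mul_sum]
        rw [sum_comm]
        exact sum_le_sum fun i _ => hc i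
    _ ≤ ∑ k ∈ range (L + 1), |p.eval (a + k * h)| * 32 ^ L := by
        refine sum_le_sum fun k hk => ?_
        gcongr
        exact sum_abs_coeff_lagrange_basis_le (by have := mem_range.1 hk; omega) hh hv _
    _ = 32 ^ L * ∑ k ∈ range (L + 1), |p.eval (a + k * h)| := by rw [← sum_mul, mul_comm]

/-! ### Interleaved subgrids -/

lemma sum_range_mul_eq_sum_sum {β : Type*} [AddCommMonoid β] (f : ℕ → β) (s n : ℕ) :
    ∑ i ∈ range (n * s), f i = ∑ k ∈ range n, ∑ g ∈ range s, f (k * s + g) := by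
  induction n with
  | zero => simp
  | succ n ih => rw [Nat.succ_mul, sum_range_add, ih, sum_range_succ]

/-- Rounding down a quotient that is at least 1 loses less than a factor 2; this is the spacing
condition for the subgrids. -/
lemma le_two_mul_succ_mul_div {L M : ℕ} (hM : L + 1 ≤ M) :
    M ≤ 2 * (L + 1) * (M / (L + 1)) := by
  have h1 : 1 ≤ M / (L + 1) := (Nat.one_le_div_iff (by omega)).2 hM
  have h2 := Nat.div_add_mod M (L + 1)
  have h3 := Nat.mod_lt M (show 0 < L + 1 by omega)
  nlinarith

/-- The bound of `sum_abs_coeff_le_sum_abs_eval` for every `M / (L + 1)`-th point of the grid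
`{1/M, …, 1}`. -/
lemma sum_abs_coeff_le_sum_abs_eval_grid {L M g : ℕ} (hM : L + 1 ≤ M) (hg : g < M / (L + 1))
    {p : ℝ[X]} (hp : p.natDegree ≤ L) :
    ∑ i ∈ range (L + 1), |p.coeff i| ≤
      32 ^ L * ∑ k ∈ range (L + 1),
        |p.eval ((((k * (M / (L + 1)) + g : ℕ) : ℝ) + 1) / M)| := by
  have hM0 : (0 : ℝ) < M := by exact_mod_cast (by omega : 0 < M)
  have hle := le_two_mul_succ_mul_div hM
  have hmul : (L + 1) * (M / (L + 1)) ≤ M := Nat.mul_div_le _ _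
  set s := M / (L + 1)
  have hnode : ∀ k : ℕ, (((k * s + g : ℕ) : ℝ) + 1) / M = ((g : ℝ) + 1) / M + k * (s / M) := by
    intro k; push_cast; ring
  simp only [hnode]
  refine sum_abs_coeff_le_sum_abs_eval ?_ (fun j hj => ?_) hp
  · rw [← mul_div_assoc, le_div_iff₀ hM0, one_mul]
    exact_mod_cast hle
  · rw [← hnode, abs_of_nonneg (by positivity), div_le_one hM0]
    have : j * s + g + 1 ≤ M := by nlinarith [Nat.mul_le_mul_right s hj]
    exact_mod_cast this

/-- Using every offset `g`, not just one, produces the factor `M` on the left, which cancels the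
normalization `1 / √M`. -/
lemma sq_sum_abs_coeff_le {L M : ℕ} (hM : L + 1 ≤ M) {p : ℝ[X]} (hp : p.natDegree ≤ L) :
    M * (∑ i ∈ range (L + 1), |p.coeff i|) ^ 2 ≤
      2 * ((L : ℝ) + 1) ^ 2 * (32 ^ L) ^ 2 * ∑ i : Fin M, p.eval (gridPoint M i) ^ 2 := by
  have hle : (M : ℝ) ≤ 2 * (L + 1) * (M / (L + 1) : ℕ) := by
    exact_mod_cast le_two_mul_succ_mul_div hM
  have hmul : (L + 1) * (M / (L + 1)) ≤ M := Nat.mul_div_le _ _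
  set S := ∑ i ∈ range (L + 1), |p.coeff i| with hS
  set f : ℕ → ℝ := fun i => p.eval (((i : ℝ) + 1) / M) ^ 2 with hf
  have hgroup : ∀ g ∈ range (M / (L + 1)),
      S ^ 2 ≤ (32 ^ L) ^ 2 * ((L + 1) * ∑ k ∈ range (L + 1), f (k * (M / (L + 1)) + g)) := by
    intro g hg
    have h0 : 0 ≤ S := sum_nonneg fun _ _ => abs_nonneg _
    refine (pow_le_pow_left₀ h0
      (sum_abs_coeff_le_sum_abs_eval_grid hM (mem_range.1 hg) hp) 2).trans ?_
    rw [mul_pow]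
    gcongr
    refine sq_sum_le_card_mul_sum_sq.trans (le_of_eq ?_)
    simp only [card_range, sq_abs, hf]
    push_cast
    rfl
  have hsum := sum_le_sum hgroup
  rw [sum_const, card_range, nsmul_eq_mul, ← mul_sum, ← mul_sum, sum_comm,
    ← sum_range_mul_eq_sum_sum] at hsum
  have hgrid : ∑ i ∈ range ((L + 1) * (M / (L + 1))), f i ≤
      ∑ i : Fin M, p.eval (gridPoint M i) ^ 2 := by
    refine (sum_le_sum_of_subset_of_nonneg (range_mono hmul) fun _ _ _ => sq_nonneg _).trans ?_
    rw [sum_range]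
    rfl
  calc M * S ^ 2 ≤ 2 * (L + 1) * (M / (L + 1) : ℕ) * S ^ 2 := by gcongr
    _ = 2 * (L + 1) * ((M / (L + 1) : ℕ) * S ^ 2) := by ring
    _ ≤ 2 * (L + 1) * ((32 ^ L) ^ 2 * ((L + 1) * ∑ i : Fin M, p.eval (gridPoint M i) ^ 2)) := by
      exact mul_le_mul_of_nonneg_left (hsum.trans (by gcongr)) (by positivity)
    _ = _ := by ring

/-! ### Smallest singular value and final bounds -/

/-- A lower bound for the smallest singular value from a lower bound for the quadratic form. -/
lemma le_sigmaMin {m n : ℕ} (hn : 0 < n) (A : Matrix (Fin m) (Fin n) ℝ) {r : ℝ}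
    (h : ∀ w : Fin n → ℝ, r ^ 2 * ∑ j, w j ^ 2 ≤ ∑ i, (A.mulVec w) i ^ 2) : r ≤ sigmaMin A := by
  set T := Matrix.toEuclideanLin A
  have hlt : n - 1 < Module.finrank ℝ (EuclideanSpace ℝ (Fin n)) := by
    rw [finrank_euclideanSpace_fin]; omega
  -- The quadratic form is tested on an eigenvector of the Gram operator for the last singular
  -- value.
  obtain ⟨x, hx⟩ := (T.hasEigenvalue_adjoint_comp_self_sq_singularValues hlt).exists_hasEigenvector
  have hTx : ‖T x‖ ^ 2 = sigmaMin A ^ 2 * ‖x‖ ^ 2 := by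
    rw [← real_inner_self_eq_norm_sq, ← LinearMap.adjoint_inner_left, ← LinearMap.comp_apply,
      hx.apply_eq_smul, real_inner_smul_left, real_inner_self_eq_norm_sq]
    rfl
  have hxpos : 0 < ‖x‖ ^ 2 := pow_pos (norm_pos_iff.2 hx.2) 2
  have hr := h x.ofLp
  have h1 : ∑ j, x.ofLp j ^ 2 = ‖x‖ ^ 2 := (EuclideanSpace.real_norm_sq_eq x).symm
  have h2 : ∑ i, (A.mulVec x.ofLp) i ^ 2 = ‖T x‖ ^ 2 :=
    (EuclideanSpace.real_norm_sq_eq (T x)).symm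
  rw [h1, h2, hTx] at hr
  exact le_of_sq_le_sq (le_of_mul_le_mul_right hr hxpos) (T.singularValues_nonneg _)

lemma le_sigmaMin_vandermondeGrid {L M : ℕ} (hM : L + 1 ≤ M) :
    1 / (2 * ((L : ℝ) + 1) * 32 ^ L) ≤ sigmaMin ((1 / Real.sqrt M) • vandermondeGrid M L) := by
  have hM0 : (0 : ℝ) < M := by exact_mod_cast (by omega : 0 < M)
  refine le_sigmaMin L.succ_pos _ fun w => ?_
  set p : ℝ[X] := ∑ j : Fin (L + 1), C (w j) * X ^ (j : ℕ) with hp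
  have hcoeff : ∀ j : Fin (L + 1), p.coeff j = w j := by
    intro j
    simp [hp, finsetSum_coeff, coeff_X_pow, Fin.val_inj]
  have hdeg : p.natDegree ≤ L := by
    refine natDegree_sum_le_of_forall_le _ _ fun j _ => ?_
    exact (natDegree_C_mul_X_pow_le _ _).trans (by omega)
  have hmv : ∀ i : Fin M, ((1 / Real.sqrt M) • vandermondeGrid M L).mulVec w i =
      1 / Real.sqrt M * p.eval (gridPoint M i) := by
    intro i
    rw [Matrix.smul_mulVec, Pi.smul_apply, smul_eq_mul]
    congr 1
    simp only [hp, eval_finsetSum, eval_mul, eval_C, eval_pow, eval_X, Matrix.mulVec, dotProduct,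
      vandermondeGrid, Matrix.of_apply]
    exact sum_congr rfl fun _ _ => mul_comm _ _
  have hw : ∑ j, w j ^ 2 ≤ (∑ i ∈ range (L + 1), |p.coeff i|) ^ 2 := by
    rw [sum_range]
    simp only [hcoeff]
    refine (le_of_eq ?_).trans (sum_sq_le_sq_sum_of_nonneg fun j _ => abs_nonneg (w j))
    simp only [sq_abs]
  simp only [hmv, mul_pow, ← mul_sum, div_pow, one_pow, Real.sq_sqrt hM0.le]
  have key := sq_sum_abs_coeff_le hM hdeg
  set E := ∑ i : Fin M, p.eval (gridPoint M i) ^ 2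
  have hE : 0 ≤ E := sum_nonneg fun _ _ => sq_nonneg _
  rw [div_mul_eq_mul_div, div_mul_eq_mul_div, div_le_div_iff₀ (by positivity) hM0]
  nlinarith [mul_le_mul_of_nonneg_left hw hM0.le,
    (by positivity : 0 ≤ ((L : ℝ) + 1) ^ 2 * (32 ^ L) ^ 2 * E)]

lemma abs_coeff_le_iSup_grid {L M : ℕ} (hM : L + 1 ≤ M) {p : ℝ[X]} (hp : p.natDegree ≤ L) {i : ℕ}
    (hi : i ≤ L) : |p.coeff i| ≤ (⨆ k : Fin M, |p.eval (gridPoint M k)|) * 64 ^ L := by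
  set B := ⨆ k : Fin M, |p.eval (gridPoint M k)|
  have hs : 0 < M / (L + 1) := Nat.div_pos hM L.succ_pos
  have hB : ∀ k : Fin M, |p.eval (gridPoint M k)| ≤ B :=
    le_ciSup (f := fun k : Fin M => |p.eval (gridPoint M k)|) (Set.finite_range _).bddAbove
  have hB0 : 0 ≤ B := Real.iSup_nonneg fun _ => abs_nonneg _
  -- The number of nodes is absorbed into the exponential: 64 = 32 · 2.
  have hL : (L : ℝ) + 1 ≤ 2 ^ L := by exact_mod_cast Nat.lt_two_pow_self
  calc |p.coeff i| ≤ ∑ i ∈ range (L + 1), |p.coeff i| :=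
        single_le_sum (f := fun i => |p.coeff i|) (fun _ _ => abs_nonneg _)
          (mem_range.2 (by omega))
    _ ≤ 32 ^ L * ∑ k ∈ range (L + 1), |p.eval ((((k * (M / (L + 1)) + 0 : ℕ) : ℝ) + 1) / M)| :=
        sum_abs_coeff_le_sum_abs_eval_grid hM hs hp
    _ ≤ 32 ^ L * ∑ k ∈ range (L + 1), B := by
        gcongr with k hk
        have hk := mem_range.1 hk
        have h1 : (k + 1) * (M / (L + 1)) ≤ M :=
          (Nat.mul_le_mul_right _ (by omega)).trans (Nat.mul_div_le M (L + 1))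
        rw [Nat.succ_mul] at h1
        exact hB ⟨k * (M / (L + 1)) + 0, by omega⟩
    _ = B * (32 ^ L * ((L : ℝ) + 1)) := by
        rw [sum_const, card_range, nsmul_eq_mul]; push_cast; ring
    _ ≤ B * 64 ^ L := by
        rw [show (64 : ℝ) = 32 * 2 by norm_num, mul_pow]
        gcongr

theorem mainTheorem5 :
    (∀ L M : ℕ, 1 ≤ L → L + 1 ≤ M →
      1 / ((L : ℝ) ^ 2 * 2 ^ (7 * L) * (2 * (L : ℝ) + 1)) *
          (((M : ℝ) + L) / (Real.exp 1 * M)) ^ ((L : ℝ) + 1 / 2) ≤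
        sigmaMin ((1 / Real.sqrt M) • vandermondeGrid M L)) ∧
    (∃ c : ℝ, 0 < c ∧ ∀ L M : ℕ, L + 1 ≤ M → ∀ p : Polynomial ℝ, p.natDegree ≤ L →
      ∀ i : ℕ, i ≤ L →
        |p.coeff i| ≤ (⨆ k : Fin M, |p.eval (gridPoint M k)|) * Real.exp (c * L)) := by
  refine ⟨fun L M hL hM => ?_, Real.log 64, Real.log_pos (by norm_num), fun L M hM p hp i hi => ?_⟩
  · refine le_trans ?_ (le_sigmaMin_vandermondeGrid hM)
    have hL1 : (1 : ℝ) ≤ L := by exact_mod_cast hL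
    have hLM : (L : ℝ) ≤ M := by exact_mod_cast (by omega : L ≤ M)
    have hM0 : (0 : ℝ) < M := by linarith
    have he : (2 : ℝ) ≤ Real.exp 1 := by linarith [Real.add_one_le_exp (1 : ℝ)]
    -- Since `M + L ≤ 2 M ≤ e M`, this factor can be discarded.
    have hpow : (((M : ℝ) + L) / (Real.exp 1 * M)) ^ ((L : ℝ) + 1 / 2) ≤ 1 := by
      refine Real.rpow_le_one (by positivity) ?_ (by positivity)
      rw [div_le_one (by positivity)]
      nlinarith
    -- The spare `4 ^ L` is at least 4, which more than covers the constant 2 in `2 (L + 1)`.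
    have h128 : (2 : ℝ) ^ (7 * L) = 32 ^ L * 4 ^ L := by
      rw [pow_mul, ← mul_pow]; norm_num
    have h4 : (4 : ℝ) ≤ 4 ^ L := le_self_pow₀ (by norm_num) (by omega)
    refine (mul_le_of_le_one_right (by positivity) hpow).trans ?_
    refine one_div_le_one_div_of_le (by positivity) ?_
    rw [h128]
    calc 2 * ((L : ℝ) + 1) * 32 ^ L ≤ (1 * 4 * (2 * L + 1)) * 32 ^ L :=
          mul_le_mul_of_nonneg_right (by linarith) (by positivity)
      _ ≤ ((L : ℝ) ^ 2 * 4 ^ L * (2 * L + 1)) * 32 ^ L := by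
        gcongr
        exact one_le_pow₀ hL1
      _ = _ := by ring
  · rw [mul_comm (Real.log 64), Real.exp_nat_mul, Real.exp_log (by norm_num)]
    exact abs_coeff_le_iSup_grid hM hp hi
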